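/- For every real number $\epsilon>0$ there are constants $C=C_\epsilon>0$ and $K=K_\epsilon>0$, depending only on $\epsilon$, such that the following holds for every positive integer $N$. The set of exceptional $\alpha\in[0,1)$ has Lebesgue measure at most $K/\sqrt{\log N}$ (read as $+\infty$ when $N=1$), where $\alpha$ is called non-exceptional if: for all integers $a$ and $q$ with $1\le q\le N^2$, $\gcd(a,q)=1$ and $$\Big|\alpha-\frac aq\Big|\le\frac1{qN^2},$$ there exist integers $a_1,a_2$ and integers $1\le q_1,q_2\le N$ such that $$\Big|\alpha-\frac{a_1}{q_1}-\frac{a_2}{q_2}\Big|\le\frac{C}{qN^{2-\epsilon}}.$$ -/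

import Mathlib

/-- For the real number `α`, with implied constant `C`: for every rational approximation `a / q`
of `α` in lowest terms with `1 ≤ q ≤ N ^ 2` and `|α - a / q| ≤ 1 / (q N ^ 2)`, there are integers
`a₁`, `a₂` and `1 ≤ q₁, q₂ ≤ N` with `|α - a₁ / q₁ - a₂ / q₂| ≤ C / (q N ^ (2 - ε))`. -/
def TwoRationalApprox (C ε : ℝ) (N : ℕ) (α : ℝ) : Prop :=
  ∀ (a : ℤ) (q : ℕ), 1 ≤ q → q ≤ N ^ 2 → IsCoprime a (q : ℤ) →
    |α - (a : ℝ) / (q : ℝ)| ≤ 1 / ((q : ℝ) * (N : ℝ) ^ 2) →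
    ∃ (a₁ a₂ : ℤ) (q₁ q₂ : ℕ), 1 ≤ q₁ ∧ q₁ ≤ N ∧ 1 ≤ q₂ ∧ q₂ ≤ N ∧
      |α - (a₁ : ℝ) / (q₁ : ℝ) - (a₂ : ℝ) / (q₂ : ℝ)| ≤
        C * (1 / ((q : ℝ) * (N : ℝ) ^ (2 - ε)))

open MeasureTheory

/-! Fractions `a₁/p + a₂/q` with `p`, `q` coprime are exactly the fractions `b/(pq)`, so it suffices
that `‖pqα‖ ≤ η` for some admissible pair. Take `p` prime in `(2Z, N]` and `q` in `(Z, 2Z]`, with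
`Z` about `N / (8 log N)` and `η = 2 Z² N^(δ-4)`. This gives error `N^(δ-4)`, good enough for every
denominator up to `N²`.

Almost every `α` admits such a pair, by a second moment argument. Each event `‖pqx‖ ≤ η` has measure
`2η`, and two of them are independent up to an error governed by a gcd (`volume_real_inter_le`). As
the primes exceed `2Z`, the gcd sum splits into one over primes and one over `q`, both small on
average (`sum_gcd_primes_le`, `sum_gcd_le`). Chebyshev's inequality (`measureReal_iInter_compl_le`)
then bounds the exceptional measure by a constant times `(log N)^6 / N^δ`. -/

/-! ### Overlaps of Bohr sets on the circle -/

theorem volume_real_setOf_norm_nsmul_le {n : ℕ} (hn : n ≠ 0) {η : ℝ} (h0 : 0 ≤ η)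
    (h1 : η ≤ 1 / 2) :
    volume.real {x : UnitAddCircle | ‖n • x‖ ≤ η} = 2 * η := by
  have hmp : MeasurePreserving (fun x : UnitAddCircle => (n : ℤ) • x) volume volume :=
    MeasureTheory.Measure.measurePreserving_zsmul volume (by exact_mod_cast hn)
  have hset : {x : UnitAddCircle | ‖n • x‖ ≤ η} =
      (fun x : UnitAddCircle => (n : ℤ) • x) ⁻¹' Metric.closedBall 0 η := by
    ext x
    simp
  rw [hset, measureReal_def, hmp.measure_preimage Metric.isClosed_closedBall.nullMeasurableSet,
    AddCircle.volume_closedBall, min_eq_right (by linarith), ENNReal.toReal_ofReal (by linarith)]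

theorem measurableSet_setOf_norm_nsmul_add_le (n : ℕ) (y : UnitAddCircle) (η : ℝ) :
    MeasurableSet {x : UnitAddCircle | ‖n • x + y‖ ≤ η} := by
  refine (isClosed_le ?_ continuous_const).measurableSet
  fun_prop

theorem measurableSet_setOf_norm_nsmul_le (n : ℕ) (η : ℝ) :
    MeasurableSet {x : UnitAddCircle | ‖n • x‖ ≤ η} := by
  simpa using measurableSet_setOf_norm_nsmul_add_le n 0 η

/-- Among the points `y + c m / k`, `0 ≤ c < k`, on the circle, few are close to `0`. -/
theorem card_filter_norm_add_le {k m : ℕ} (hk : 0 < k) (hm : k.Coprime m) {η : ℝ} (h0 : 0 ≤ η)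
    (y : UnitAddCircle) :
    (((Finset.range k).filter
      (fun c : ℕ => ‖y + ((c * m / k : ℝ) : UnitAddCircle)‖ ≤ η)).card : ℝ) ≤ 2 * η * k + 1 := by
  induction y using QuotientAddGroup.induction_on with
  | H y =>
  have hk' : (0 : ℝ) < k := by exact_mod_cast hk
  set s := (Finset.range k).filter
    (fun c : ℕ => ‖(y : UnitAddCircle) + ((c * m / k : ℝ) : UnitAddCircle)‖ ≤ η) with hs
  -- `j c` is congruent to `c * m` mod `k`, hence injective on `c < k` by coprimality; closeness to
  -- `0` confines it to an interval of length `2kη`.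
  let j : ℕ → ℤ := fun c => c * m - k * round (y + (c * m / k : ℝ))
  have hj : ∀ c ∈ s, j c ∈ Finset.Icc ⌈-(k * y) - k * η⌉ ⌊-(k * y) + k * η⌋ := by
    intro c hc
    have h := (Finset.mem_filter.1 hc).2
    rw [← AddCircle.coe_add, UnitAddCircle.norm_eq] at h
    have h' : |(k : ℝ) * y + j c| ≤ k * η := by
      have : (k : ℝ) * y + j c =
          k * (y + (c * m / k : ℝ) - round (y + (c * m / k : ℝ))) := by
        simp only [j]
        push_cast
        field_simp
        ring
      rw [this, abs_mul, abs_of_pos hk']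
      gcongr
    rw [abs_le] at h'
    rw [Finset.mem_Icc, Int.ceil_le, Int.le_floor]
    constructor <;> linarith [h'.1, h'.2]
  have hinj : Set.InjOn j s := by
    intro c hc d hd hcd
    have hc' := Finset.mem_range.1 (Finset.mem_filter.1 hc).1
    have hd' := Finset.mem_range.1 (Finset.mem_filter.1 hd).1
    have hdvd : (k : ℤ) ∣ ((c : ℤ) - d) * m :=
      ⟨round (y + (c * m / k : ℝ)) - round (y + (d * m / k : ℝ)), by
        simp only [j] at hcd
        linarith⟩
    have hdvd' : (k : ℤ) ∣ (c : ℤ) - d :=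
      IsCoprime.dvd_of_dvd_mul_right (Nat.isCoprime_iff_coprime.2 hm) hdvd
    have := Int.eq_zero_of_abs_lt_dvd hdvd' (by rw [abs_lt]; omega)
    omega
  have hcard := Finset.card_le_card_of_injOn j hj hinj
  rw [Int.card_Icc] at hcard
  have hnn : (0 : ℝ) ≤ 2 * η * k + 1 := by positivity
  refine le_trans (Nat.cast_le.2 hcard) ?_
  have h1 := Int.floor_le (-(k * y) + k * η)
  have h2 := Int.le_ceil (-(k * y) - k * η)
  rcases le_total 0 (⌊-(k * y) + k * η⌋ + 1 - ⌈-(k * y) - k * η⌉) with h | h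
  · have : ((⌊-(k * y) + k * η⌋ + 1 - ⌈-(k * y) - k * η⌉).toNat : ℝ) =
        ((⌊-(k * y) + k * η⌋ + 1 - ⌈-(k * y) - k * η⌉ : ℤ) : ℝ) := by
      exact_mod_cast Int.toNat_of_nonneg h
    rw [this]
    push_cast
    linarith
  · rw [Int.toNat_of_nonpos h]
    simpa using hnn

theorem sum_measureReal_le_of_card_le {Ω ι : Type*} [MeasurableSpace Ω] {μ : Measure Ω}
    [IsFiniteMeasure μ] (I : Finset ι) {S : ι → Set Ω} {D : Set Ω} {B : ℝ}
    (hS : ∀ i ∈ I, MeasurableSet (S i)) (hD : MeasurableSet D) (hSD : ∀ i ∈ I, S i ⊆ D)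
    (hB : ∀ x, ∑ i ∈ I, (S i).indicator (1 : Ω → ℝ) x ≤ B) :
    ∑ i ∈ I, μ.real (S i) ≤ B * μ.real D := by
  have hint : ∀ i ∈ I, Integrable ((S i).indicator (1 : Ω → ℝ)) μ := fun i hi =>
    (integrable_const (1 : ℝ)).indicator (hS i hi)
  calc ∑ i ∈ I, μ.real (S i) = ∫ x, ∑ i ∈ I, (S i).indicator (1 : Ω → ℝ) x ∂μ := by
        rw [integral_finsetSum _ hint]
        exact Finset.sum_congr rfl fun i hi => (integral_indicator_one (hS i hi)).symm
    _ ≤ ∫ x, B * D.indicator (1 : Ω → ℝ) x ∂μ := by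
        refine integral_mono (integrable_finsetSum _ hint)
          (((integrable_const (1 : ℝ)).indicator hD).const_mul B) fun x => ?_
        by_cases hx : x ∈ D
        · simpa [hx] using hB x
        · have : ∑ i ∈ I, (S i).indicator (1 : Ω → ℝ) x = 0 :=
            Finset.sum_eq_zero fun i hi =>
              Set.indicator_of_notMem (fun h => hx (hSD i hi h)) _
          simp [hx, this]
    _ = B * μ.real D := by rw [integral_const_mul, integral_indicator_one hD]

/-- Write `n = kg`, `m = m'g` with `g` the gcd. Translation by `c/n` preserves the first set and
shifts `m • x` by `cm'/k`. The `k` translates of the intersection have equal measure, lie in the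
first set, and cover each point at most `2ηk + 1` times. -/
theorem volume_real_inter_le {n m : ℕ} (hn : 0 < n) {η : ℝ} (h0 : 0 ≤ η) (h1 : η ≤ 1 / 2) :
    volume.real ({x : UnitAddCircle | ‖n • x‖ ≤ η} ∩ {x : UnitAddCircle | ‖m • x‖ ≤ η}) ≤
      2 * η * (2 * η + n.gcd m / n) := by
  obtain ⟨g, k, m', hg, hcop, hnk, hmk⟩ := Nat.exists_coprime' (m := n) (n := m)
    (Nat.gcd_pos_of_pos_left _ hn)
  have hgpos : 0 < g := hg
  have hk : 0 < k := Nat.pos_of_mul_pos_right (hnk ▸ hn)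
  have hgcd : n.gcd m = g := by
    rw [hnk, hmk, Nat.gcd_mul_right, hcop.gcd_eq_one, one_mul]
  have hk' : (0 : ℝ) < k := by exact_mod_cast hk
  have hg' : (0 : ℝ) < g := by exact_mod_cast hgpos
  have hn' : (0 : ℝ) < n := by exact_mod_cast hn
  let S : ℕ → Set UnitAddCircle := fun c =>
    {x | ‖n • x‖ ≤ η} ∩ {x | ‖m • x + ((c * m' / k : ℝ) : UnitAddCircle)‖ ≤ η}
  have hSm : ∀ c, MeasurableSet (S c) := fun c =>
    (measurableSet_setOf_norm_nsmul_le n η).inter (measurableSet_setOf_norm_nsmul_add_le m _ η)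
  have hSvol : ∀ c, volume.real (S c) = volume.real
      ({x : UnitAddCircle | ‖n • x‖ ≤ η} ∩ {x : UnitAddCircle | ‖m • x‖ ≤ η}) := by
    intro c
    have hpre : S c = (fun x : UnitAddCircle => x + ((c / n : ℝ) : UnitAddCircle)) ⁻¹'
        ({x : UnitAddCircle | ‖n • x‖ ≤ η} ∩ {x : UnitAddCircle | ‖m • x‖ ≤ η}) := by
      have e1 : n • ((c / n : ℝ) : UnitAddCircle) = 0 := by
        rw [← AddCircle.coe_nsmul, nsmul_eq_mul, mul_div_cancel₀ _ hn'.ne']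
        have : ((c : ℝ) : UnitAddCircle) = ((c • (1 : ℝ) : ℝ) : UnitAddCircle) := by simp
        rw [this, AddCircle.coe_nsmul, AddCircle.coe_period, smul_zero]
      have e2 : m • ((c / n : ℝ) : UnitAddCircle) = ((c * m' / k : ℝ) : UnitAddCircle) := by
        rw [← AddCircle.coe_nsmul, nsmul_eq_mul]
        congr 1
        rw [hnk, hmk]
        push_cast
        field_simp
      ext x
      simp only [S, Set.mem_inter_iff, Set.mem_ofPred_eq, Set.mem_preimage, smul_add, e1, e2,
        add_zero]
    rw [hpre, measureReal_def, measure_preimage_add_right, measureReal_def]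
  have key := sum_measureReal_le_of_card_le (μ := (volume : Measure UnitAddCircle))
    (Finset.range k) (S := S) (D := {x : UnitAddCircle | ‖n • x‖ ≤ η}) (B := 2 * η * k + 1)
    (fun c _ => hSm c) (measurableSet_setOf_norm_nsmul_le n η)
    (fun c _ => Set.inter_subset_left) (fun x => by
      refine le_trans ?_
        (card_filter_norm_add_le hk hcop h0 (m • x))
      rw [Finset.card_filter, Nat.cast_sum]
      refine Finset.sum_le_sum fun c _ => ?_
      by_cases hx : x ∈ S c
      · have h2 : ‖m • x + ((c * m' / k : ℝ) : UnitAddCircle)‖ ≤ η := hx.2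
        rw [Set.indicator_of_mem hx, if_pos h2]
        simp
      · rw [Set.indicator_of_notMem hx]
        split_ifs <;> norm_num)
  rw [Finset.sum_congr rfl fun c _ => hSvol c, Finset.sum_const, Finset.card_range,
    nsmul_eq_mul, volume_real_setOf_norm_nsmul_le hn.ne' h0 h1] at key
  rw [hgcd]
  have e : (g : ℝ) / n = 1 / k := by
    rw [hnk]
    push_cast
    field_simp
  rw [e, ← mul_le_mul_iff_right₀ hk']
  refine key.trans (le_of_eq ?_)
  field_simp

/-! ### Second moment method -/

/-- Chebyshev's inequality for the number of events that occur. -/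
theorem measureReal_iInter_compl_le {Ω ι : Type*} [MeasurableSpace Ω] {μ : Measure Ω}
    [IsProbabilityMeasure μ] (I : Finset ι) {E : ι → Set Ω} {s : ℝ} {e : ι → ι → ℝ}
    (hE : ∀ i ∈ I, MeasurableSet (E i)) (hs : ∀ i ∈ I, μ.real (E i) = s)
    (he : ∀ i ∈ I, ∀ j ∈ I, μ.real (E i ∩ E j) ≤ s ^ 2 + e i j) :
    (I.card * s) ^ 2 * μ.real {x | ∀ i ∈ I, x ∉ E i} ≤ ∑ i ∈ I, ∑ j ∈ I, e i j := by
  set U : Set Ω := {x | ∀ i ∈ I, x ∉ E i} with hU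
  have hUm : MeasurableSet U := by
    have : U = ⋂ i ∈ I, (E i)ᶜ := by ext x; simp [hU]
    rw [this]
    exact Finset.measurableSet_biInter _ fun i hi => (hE i hi).compl
  let F : Ω → ℝ := fun x => ∑ i ∈ I, (E i).indicator (1 : Ω → ℝ) x
  have hint : ∀ i ∈ I, Integrable ((E i).indicator (1 : Ω → ℝ)) μ := fun i hi =>
    (integrable_const (1 : ℝ)).indicator (hE i hi)
  have hint2 : ∀ i ∈ I, ∀ j ∈ I, Integrable ((E i ∩ E j).indicator (1 : Ω → ℝ)) μ :=
    fun i hi j hj => (integrable_const (1 : ℝ)).indicator ((hE i hi).inter (hE j hj))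
  have hF : Integrable F μ := integrable_finsetSum _ hint
  have hF2eq : (fun x => F x ^ 2) =
      fun x => ∑ i ∈ I, ∑ j ∈ I, (E i ∩ E j).indicator (1 : Ω → ℝ) x := by
    funext x
    simp only [F, sq, Finset.sum_mul_sum]
    refine Finset.sum_congr rfl fun i _ => Finset.sum_congr rfl fun j _ => ?_
    rw [Set.inter_indicator_one]
    rfl
  have hF2 : Integrable (fun x => F x ^ 2) μ := by
    rw [hF2eq]
    exact integrable_finsetSum _ fun i hi => integrable_finsetSum _ (hint2 i hi)
  have iF : ∫ x, F x ∂μ = I.card * s := by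
    simp only [F]
    rw [integral_finsetSum _ hint, Finset.sum_congr rfl fun i hi =>
      (integral_indicator_one (hE i hi)).trans (hs i hi), Finset.sum_const, nsmul_eq_mul]
  have iF2 : ∫ x, F x ^ 2 ∂μ ≤ (I.card * s) ^ 2 + ∑ i ∈ I, ∑ j ∈ I, e i j := by
    rw [hF2eq, integral_finsetSum _ fun i hi => integrable_finsetSum _ (hint2 i hi)]
    calc _ = ∑ i ∈ I, ∑ j ∈ I, μ.real (E i ∩ E j) := by
          refine Finset.sum_congr rfl fun i hi => ?_
          rw [integral_finsetSum _ (hint2 i hi)]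
          exact Finset.sum_congr rfl fun j hj =>
            integral_indicator_one ((hE i hi).inter (hE j hj))
      _ ≤ ∑ i ∈ I, ∑ j ∈ I, (s ^ 2 + e i j) :=
          Finset.sum_le_sum fun i hi => Finset.sum_le_sum fun j hj => he i hi j hj
      _ = _ := by
          simp only [Finset.sum_add_distrib, Finset.sum_const, nsmul_eq_mul]
          ring
  calc (I.card * s) ^ 2 * μ.real U
      = ∫ x, (I.card * s) ^ 2 * U.indicator (1 : Ω → ℝ) x ∂μ := by
        rw [integral_const_mul, integral_indicator_one hUm]
    -- The integrand is `(F - mean)²`, which equals `mean²` on `U`, where `F = 0`.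
    _ ≤ ∫ x, (F x ^ 2 - 2 * (I.card * s) * F x + (I.card * s) ^ 2) ∂μ := by
        refine integral_mono (((integrable_const (1 : ℝ)).indicator hUm).const_mul _)
          ((hF2.sub (hF.const_mul _)).add (integrable_const _)) fun x => ?_
        by_cases hx : x ∈ U
        · have : F x = 0 :=
            Finset.sum_eq_zero fun i hi => Set.indicator_of_notMem (hx i hi) _
          simp [hx, this]
        · simp only [Set.indicator_of_notMem hx]
          nlinarith [sq_nonneg (F x - I.card * s)]
    _ = ∫ x, F x ^ 2 ∂μ - 2 * (I.card * s) * (I.card * s) + (I.card * s) ^ 2 := by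
        rw [integral_add (f := fun x => F x ^ 2 - 2 * (I.card * s) * F x)
          (hF2.sub (hF.const_mul _)) (integrable_const _),
          integral_sub hF2 (hF.const_mul _), integral_const_mul, iF, integral_const]
        simp
    _ ≤ _ := by linarith

/-! ### Sums of greatest common divisors -/

/-- The gcd is at most the sum of all common divisors; each `d` divides at most `Y/d` of the
integers, which leaves a harmonic sum. -/
theorem sum_gcd_le (Y : ℕ) :
    (∑ a ∈ Finset.Ioc 0 Y, ∑ b ∈ Finset.Ioc 0 Y, (a.gcd b : ℝ)) ≤ Y ^ 2 * (1 + Real.log Y) := by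
  have h1 : ∀ a ∈ Finset.Ioc 0 Y, ∀ b ∈ Finset.Ioc 0 Y, (a.gcd b : ℝ) ≤
      ∑ d ∈ Finset.Ioc 0 Y, (d : ℝ) * ((if d ∣ a then 1 else 0) * (if d ∣ b then 1 else 0)) := by
    intro a ha b hb
    rw [Finset.mem_Ioc] at ha hb
    have hmem : a.gcd b ∈ Finset.Ioc 0 Y := Finset.mem_Ioc.2
      ⟨Nat.gcd_pos_of_pos_left _ ha.1, (Nat.gcd_le_left _ ha.1).trans ha.2⟩
    refine le_trans (le_of_eq ?_) (Finset.single_le_sum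
      (f := fun d : ℕ => (d : ℝ) * ((if d ∣ a then 1 else 0) * (if d ∣ b then 1 else 0)))
      (fun d _ => by positivity) hmem)
    simp [Nat.gcd_dvd_left, Nat.gcd_dvd_right]
  have hcount : ∀ d : ℕ, ∑ a ∈ Finset.Ioc 0 Y, (if d ∣ a then (1 : ℝ) else 0) ≤ Y / d := by
    intro d
    rw [Finset.sum_boole, Nat.Ioc_filter_dvd_card_eq_div]
    exact Nat.cast_div_le
  calc (∑ a ∈ Finset.Ioc 0 Y, ∑ b ∈ Finset.Ioc 0 Y, (a.gcd b : ℝ))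
      ≤ ∑ a ∈ Finset.Ioc 0 Y, ∑ b ∈ Finset.Ioc 0 Y, ∑ d ∈ Finset.Ioc 0 Y,
          (d : ℝ) * ((if d ∣ a then 1 else 0) * (if d ∣ b then 1 else 0)) :=
        Finset.sum_le_sum fun a ha => Finset.sum_le_sum fun b hb => h1 a ha b hb
    _ = ∑ d ∈ Finset.Ioc 0 Y, (d : ℝ) * ((∑ a ∈ Finset.Ioc 0 Y, if d ∣ a then 1 else 0) *
          ∑ b ∈ Finset.Ioc 0 Y, if d ∣ b then 1 else 0) := by
        simp only [Finset.sum_mul_sum]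
        simp only [Finset.mul_sum]
        rw [Finset.sum_congr rfl fun a _ => Finset.sum_comm, Finset.sum_comm]
    _ ≤ ∑ d ∈ Finset.Ioc 0 Y, (d : ℝ) * ((Y / d) * (Y / d)) := by
        refine Finset.sum_le_sum fun d _ => ?_
        have h0 : (0 : ℝ) ≤ ∑ a ∈ Finset.Ioc 0 Y, if d ∣ a then (1 : ℝ) else 0 :=
          Finset.sum_nonneg fun _ _ => by positivity
        gcongr
        · exact hcount d
        · exact hcount d
    _ = Y ^ 2 * ((harmonic Y : ℚ) : ℝ) := by
        rw [harmonic_eq_sum_Icc, Rat.cast_sum, Finset.mul_sum]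
        refine Finset.sum_congr rfl fun d hd => ?_
        have : (d : ℝ) ≠ 0 := by
          have := (Finset.mem_Ioc.1 hd).1
          positivity
        push_cast
        field_simp
    _ ≤ _ := by
        gcongr
        exact harmonic_le_one_add_log Y

theorem sum_gcd_primes_le (Q : Finset ℕ) {N : ℕ} (hQ : ∀ p ∈ Q, p.Prime ∧ p ≤ N) :
    (∑ p ∈ Q, ∑ p' ∈ Q, (p.gcd p' : ℝ)) ≤ Q.card ^ 2 + Q.card * N := by
  have h1 : ∀ p ∈ Q, ∑ p' ∈ Q, (p.gcd p' : ℝ) ≤ Q.card + N := by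
    intro p hp
    calc ∑ p' ∈ Q, (p.gcd p' : ℝ) ≤ ∑ p' ∈ Q, (1 + if p = p' then (N : ℝ) else 0) := by
          refine Finset.sum_le_sum fun p' hp' => ?_
          split_ifs with h
          · subst h
            have : (p : ℝ) ≤ N := by exact_mod_cast (hQ p hp).2
            rw [Nat.gcd_self]
            linarith
          · rw [((Nat.coprime_primes (hQ p hp).1 (hQ p' hp').1).2 h).gcd_eq_one]
            simp
      _ = Q.card + N := by
          rw [Finset.sum_add_distrib, Finset.sum_ite_eq, if_pos hp]
          simp
  calc _ ≤ ∑ p ∈ Q, ((Q.card : ℝ) + N) := Finset.sum_le_sum h1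
    _ = _ := by
      rw [Finset.sum_const, nsmul_eq_mul]
      ring

/-- The two cross gcds are trivial. -/
theorem gcd_mul_le_of_coprime {p q p' q' : ℕ} (h1 : p.Coprime q') (h2 : q.Coprime p')
    (hp : 0 < p) (hq : 0 < q) :
    (p * q).gcd (p' * q') ≤ p.gcd p' * q.gcd q' := by
  refine Nat.le_of_dvd (Nat.mul_pos (Nat.gcd_pos_of_pos_left _ hp)
    (Nat.gcd_pos_of_pos_left _ hq)) ?_
  refine (Nat.gcd_mul_left_dvd_mul_gcd _ _ _).trans ?_
  rw [Nat.Coprime.gcd_mul_right_cancel_right _ h1.symm,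
    Nat.Coprime.gcd_mul_left_cancel_right _ h2.symm]

/-- Bound for the measure of the points of the circle that no product of a prime of a given set
and an integer of `(Z, 2 Z]` brings close to `0`. -/
theorem volume_real_not_close_le {N Z : ℕ} (Q : Finset ℕ)
    (hQ : ∀ p ∈ Q, p.Prime ∧ p ≤ N ∧ 2 * Z < p) (hQ0 : Q.Nonempty) (hZ : 0 < Z) {η : ℝ}
    (h0 : 0 < η) (h1 : η ≤ 1 / 2) :
    volume.real {x : UnitAddCircle | ∀ i ∈ Q ×ˢ Finset.Ioc Z (2 * Z),
      x ∉ {x : UnitAddCircle | ‖(i.1 * i.2) • x‖ ≤ η}} ≤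
      (1 + N / Q.card) * (1 + Real.log (2 * Z)) / (η * Z ^ 2) := by
  have hZ' : (0 : ℝ) < Z := by exact_mod_cast hZ
  have hP : (0 : ℝ) < Q.card := by exact_mod_cast hQ0.card_pos
  have hcop : ∀ p ∈ Q, ∀ q ∈ Finset.Ioc Z (2 * Z), p.Coprime q := by
    intro p hp q hq
    rw [Finset.mem_Ioc] at hq
    have := hQ p hp
    exact Nat.coprime_of_lt_prime (by omega) (by omega) this.1
  have hpos : ∀ i ∈ Q ×ˢ Finset.Ioc Z (2 * Z), 0 < i.1 ∧ 0 < i.2 ∧ 2 * Z * Z ≤ i.1 * i.2 := by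
    intro i hi
    rw [Finset.mem_product, Finset.mem_Ioc] at hi
    have := hQ _ hi.1
    exact ⟨by omega, by omega, Nat.mul_le_mul (by omega) (by omega)⟩
  have hcard : (Q ×ˢ Finset.Ioc Z (2 * Z)).card = Q.card * Z := by
    rw [Finset.card_product, Nat.card_Ioc]
    congr 1
    omega
  have : IsProbabilityMeasure (volume : Measure UnitAddCircle) :=
    ⟨UnitAddCircle.measure_univ⟩
  have key := measureReal_iInter_compl_le (μ := (volume : Measure UnitAddCircle))
    (Q ×ˢ Finset.Ioc Z (2 * Z))
    (E := fun i => {x : UnitAddCircle | ‖(i.1 * i.2) • x‖ ≤ η}) (s := 2 * η)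
    -- The overlap error is `2η` times the gcd over `pq`, and `pq ≥ 2Z²`.
    (e := fun i j => η / Z ^ 2 * (i.1.gcd j.1 * i.2.gcd j.2))
    (fun i _ => measurableSet_setOf_norm_nsmul_le _ η)
    (fun i hi => volume_real_setOf_norm_nsmul_le
      (Nat.mul_pos (hpos i hi).1 (hpos i hi).2.1).ne' h0.le h1)
    (fun i hi j hj => by
      obtain ⟨hi1, hi2, hi3⟩ := hpos i hi
      refine (volume_real_inter_le (Nat.mul_pos hi1 hi2) h0.le h1).trans ?_
      have hg : ((i.1 * i.2).gcd (j.1 * j.2) : ℝ) ≤ i.1.gcd j.1 * i.2.gcd j.2 := by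
        rw [Finset.mem_product] at hi hj
        exact_mod_cast gcd_mul_le_of_coprime (hcop _ hi.1 _ hj.2)
          (hcop _ hj.1 _ hi.2).symm hi1 hi2
      have hn : (2 * Z * Z : ℝ) ≤ ((i.1 * i.2 : ℕ) : ℝ) := by exact_mod_cast hi3
      have : ((i.1 * i.2).gcd (j.1 * j.2) : ℝ) / ((i.1 * i.2 : ℕ) : ℝ) ≤
          (i.1.gcd j.1 * i.2.gcd j.2) / (2 * Z * Z) := by gcongr
      calc 2 * η * (2 * η + ((i.1 * i.2).gcd (j.1 * j.2) : ℝ) / ((i.1 * i.2 : ℕ) : ℝ))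
          ≤ 2 * η * (2 * η + (i.1.gcd j.1 * i.2.gcd j.2) / (2 * Z * Z)) := by gcongr
        _ = _ := by
          field_simp)
  have hsum : ∑ i ∈ Q ×ˢ Finset.Ioc Z (2 * Z), ∑ j ∈ Q ×ˢ Finset.Ioc Z (2 * Z),
      η / (Z : ℝ) ^ 2 * ((i.1.gcd j.1 : ℝ) * i.2.gcd j.2) ≤
      η / Z ^ 2 * ((Q.card ^ 2 + Q.card * N) * ((2 * Z : ℕ) ^ 2 *
        (1 + Real.log (2 * Z : ℕ)))) := by
    have hsub : Finset.Ioc Z (2 * Z) ⊆ Finset.Ioc 0 (2 * Z) :=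
      Finset.Ioc_subset_Ioc_left (Nat.zero_le _)
    have hq : (∑ a ∈ Finset.Ioc Z (2 * Z), ∑ b ∈ Finset.Ioc Z (2 * Z), (a.gcd b : ℝ)) ≤
        (2 * Z : ℕ) ^ 2 * (1 + Real.log (2 * Z : ℕ)) := by
      refine le_trans ?_ (sum_gcd_le (2 * Z))
      calc _ ≤ ∑ a ∈ Finset.Ioc Z (2 * Z), ∑ b ∈ Finset.Ioc 0 (2 * Z), (a.gcd b : ℝ) :=
            Finset.sum_le_sum fun a _ =>
              Finset.sum_le_sum_of_subset_of_nonneg hsub fun _ _ _ => by positivity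
        _ ≤ _ := Finset.sum_le_sum_of_subset_of_nonneg hsub fun _ _ _ => by positivity
    have hp := sum_gcd_primes_le Q (N := N) fun p hp => ⟨(hQ p hp).1, (hQ p hp).2.1⟩
    have hfac : ∑ i ∈ Q ×ˢ Finset.Ioc Z (2 * Z), ∑ j ∈ Q ×ˢ Finset.Ioc Z (2 * Z),
        η / (Z : ℝ) ^ 2 * ((i.1.gcd j.1 : ℝ) * i.2.gcd j.2) =
        η / Z ^ 2 * ((∑ p ∈ Q, ∑ p' ∈ Q, (p.gcd p' : ℝ)) *
          ∑ a ∈ Finset.Ioc Z (2 * Z), ∑ b ∈ Finset.Ioc Z (2 * Z), (a.gcd b : ℝ)) := by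
      simp only [← Finset.mul_sum]
      congr 1
      rw [Finset.sum_mul_sum, Finset.sum_product]
      refine Finset.sum_congr rfl fun p _ => Finset.sum_congr rfl fun a _ => ?_
      rw [Finset.sum_product, Finset.sum_mul_sum]
    rw [hfac]
    have : (0 : ℝ) ≤ ∑ a ∈ Finset.Ioc Z (2 * Z), ∑ b ∈ Finset.Ioc Z (2 * Z), (a.gcd b : ℝ) :=
      Finset.sum_nonneg fun _ _ => Finset.sum_nonneg fun _ _ => by positivity
    gcongr
  have key2 := key.trans hsum
  rw [hcard] at key2
  push_cast at key2
  rw [le_div_iff₀ (by positivity)]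
  have hc : (0 : ℝ) < 4 * Q.card ^ 2 * η := by positivity
  rw [← mul_le_mul_iff_right₀ hc]
  refine le_trans (le_of_eq ?_) (key2.trans (le_of_eq ?_))
  · ring
  · field_simp
    ring

/-! ### From a small multiple of `α` to a sum of two fractions -/

theorem exists_add_div_eq {p q : ℕ} (hp : 0 < p) (hq : 0 < q) (h : p.Coprime q) (b : ℤ) :
    ∃ a₁ a₂ : ℤ, (a₁ : ℝ) / p + (a₂ : ℝ) / q = b / (p * q : ℕ) := by
  obtain ⟨u, v, huv⟩ := Nat.isCoprime_iff_coprime.2 h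
  refine ⟨b * v, b * u, ?_⟩
  have huv' : (u : ℝ) * p + v * q = 1 := by exact_mod_cast huv
  have hp' : (0 : ℝ) < p := by exact_mod_cast hp
  have hq' : (0 : ℝ) < q := by exact_mod_cast hq
  push_cast
  field_simp
  linear_combination (b : ℝ) * huv'

theorem twoRationalApprox_of_norm_nsmul_le {N p q Z : ℕ} {δ ε α : ℝ} (hδ : δ ≤ ε) (hN : 1 ≤ N)
    (hp : 0 < p) (hpN : p ≤ N) (hq : 0 < q) (hqN : q ≤ N) (h : p.Coprime q) (hZ : 0 < Z)
    (hZpq : 2 * Z * Z ≤ p * q)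
    (hα : ‖(p * q) • (α : UnitAddCircle)‖ ≤ 2 * Z ^ 2 * (N : ℝ) ^ (δ - 4)) :
    TwoRationalApprox 1 ε N α := by
  intro a r hr hrN _ _
  obtain ⟨a₁, a₂, ha⟩ := exists_add_div_eq hp hq h (round ((p * q : ℕ) * α))
  refine ⟨a₁, a₂, p, q, hp, hpN, hq, hqN, ?_⟩
  have hN' : (1 : ℝ) ≤ N := by exact_mod_cast hN
  have hN0 : (0 : ℝ) < N := by linarith
  have hr' : (0 : ℝ) < r := by exact_mod_cast hr
  have hZ' : (0 : ℝ) < Z := by exact_mod_cast hZ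
  have hrN' : (r : ℝ) ≤ (N : ℝ) ^ 2 := by exact_mod_cast hrN
  have hpq : (2 * Z * Z : ℝ) ≤ ((p * q : ℕ) : ℝ) := by exact_mod_cast hZpq
  have hpq0 : (0 : ℝ) < ((p * q : ℕ) : ℝ) := by exact_mod_cast Nat.mul_pos hp hq
  rw [← AddCircle.coe_nsmul, UnitAddCircle.norm_eq, nsmul_eq_mul] at hα
  have e : α - a₁ / p - a₂ / q =
      ((p * q : ℕ) * α - round ((p * q : ℕ) * α)) / (p * q : ℕ) := by
    rw [sub_sub, ha]
    field_simp
  rw [e, abs_div, abs_of_pos hpq0, one_mul]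
  calc _ ≤ 2 * Z ^ 2 * (N : ℝ) ^ (δ - 4) / (2 * Z * Z) := by gcongr
    _ = (N : ℝ) ^ (δ - 4) := by field_simp
    -- One factor `N²` is set aside to absorb `r ≤ N²`.
    _ ≤ (N : ℝ) ^ (-(2 + (2 - ε))) := Real.rpow_le_rpow_of_exponent_le hN' (by linarith)
    _ = 1 / ((N : ℝ) ^ 2 * (N : ℝ) ^ (2 - ε)) := by
        rw [Real.rpow_neg hN0.le, Real.rpow_add hN0, Real.rpow_two, one_div]
    _ ≤ 1 / ((r : ℝ) * (N : ℝ) ^ (2 - ε)) := by gcongr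

theorem volume_Ico_inter_preimage_coe (U : Set UnitAddCircle) (hU : MeasurableSet U) :
    volume {α : ℝ | α ∈ Set.Ico (0 : ℝ) 1 ∧ (α : UnitAddCircle) ∈ U} = volume U := by
  have h := (UnitAddCircle.measurePreserving_mk 0).measure_preimage hU.nullMeasurableSet
  have hm : MeasurableSet ((fun α : ℝ => (α : UnitAddCircle)) ⁻¹' U) :=
    (UnitAddCircle.measurePreserving_mk 0).measurable hU
  rw [zero_add, ← restrict_Ico_eq_restrict_Ioc, Measure.restrict_apply hm] at h
  rw [← h]
  congr 1
  ext x
  exact and_comm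

/-- If there are enough primes up to `N`, then the exceptional set is small. -/
theorem volume_exceptional_le {N Z : ℕ} {δ ε : ℝ} (hδ : δ ≤ ε) (Q : Finset ℕ)
    (hQ : ∀ p ∈ Q, p.Prime ∧ p ≤ N ∧ 2 * Z < p) (hQ0 : Q.Nonempty) (hZ : 0 < Z)
    (h1 : 2 * Z ^ 2 * (N : ℝ) ^ (δ - 4) ≤ 1 / 2) :
    volume {α : ℝ | α ∈ Set.Ico (0 : ℝ) 1 ∧ ¬ TwoRationalApprox 1 ε N α} ≤
      ENNReal.ofReal ((1 + N / Q.card) * (1 + Real.log (2 * Z)) /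
        (2 * Z ^ 2 * (N : ℝ) ^ (δ - 4) * Z ^ 2)) := by
  obtain ⟨p₀, hp₀⟩ := hQ0
  have hN : 1 ≤ N := (hQ p₀ hp₀).1.one_le.trans (hQ p₀ hp₀).2.1
  have hZN : 2 * Z ≤ N := (hQ p₀ hp₀).2.2.le.trans (hQ p₀ hp₀).2.1
  have hN' : (0 : ℝ) < N := by exact_mod_cast hN
  have hZ' : (0 : ℝ) < Z := by exact_mod_cast hZ
  set η : ℝ := 2 * Z ^ 2 * (N : ℝ) ^ (δ - 4) with hη
  have h0 : 0 < η := by positivity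
  set U : Set UnitAddCircle := {x : UnitAddCircle | ∀ i ∈ Q ×ˢ Finset.Ioc Z (2 * Z),
      x ∉ {x : UnitAddCircle | ‖(i.1 * i.2) • x‖ ≤ η}} with hU
  have hUm : MeasurableSet U := by
    have : U = ⋂ i ∈ Q ×ˢ Finset.Ioc Z (2 * Z),
        {x : UnitAddCircle | ‖(i.1 * i.2) • x‖ ≤ η}ᶜ := by
      ext x
      simp only [hU, Set.mem_iInter, Set.mem_compl_iff]
      rfl
    rw [this]
    exact Finset.measurableSet_biInter _ fun i _ =>
      (measurableSet_setOf_norm_nsmul_le _ η).compl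
  calc _ ≤ volume {α : ℝ | α ∈ Set.Ico (0 : ℝ) 1 ∧ (α : UnitAddCircle) ∈ U} := by
        refine measure_mono fun α hα => ⟨hα.1, fun i hi hmem => hα.2 ?_⟩
        rw [Finset.mem_product, Finset.mem_Ioc] at hi
        obtain ⟨hprime, hle, hlt⟩ := hQ _ hi.1
        exact twoRationalApprox_of_norm_nsmul_le hδ hN hprime.pos hle (by omega) (by omega)
          (Nat.coprime_of_lt_prime (by omega) (by omega) hprime) hZ
          (Nat.mul_le_mul (by omega) (by omega)) hmem
    _ = volume U := volume_Ico_inter_preimage_coe U hUm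
    _ = ENNReal.ofReal (volume.real U) := by
        rw [ofReal_measureReal (by
          refine ne_top_of_le_ne_top ENNReal.one_ne_top ?_
          rw [← UnitAddCircle.measure_univ]
          exact measure_mono (Set.subset_univ U))]
    _ ≤ _ := ENNReal.ofReal_le_ofReal
        (volume_real_not_close_le Q hQ ⟨p₀, hp₀⟩ hZ h0 h1)

/-! ### Supply of primes and choice of parameters -/

theorem primeCounting_sub_le_card (N m : ℕ) :
    (N.primeCounting : ℝ) - m ≤
      ((Finset.Ioc m N).filter Nat.Prime).card := by
  have h : N.primeCounting ≤ m + ((Finset.Ioc m N).filter Nat.Prime).card := by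
    rw [Nat.primeCounting, Nat.primeCounting', Nat.count_eq_card_filter_range]
    calc _ ≤ (Finset.Ioc 0 m ∪ (Finset.Ioc m N).filter Nat.Prime).card := by
          refine Finset.card_le_card fun p hp => ?_
          rw [Finset.mem_filter, Finset.mem_range] at hp
          have := hp.2.pos
          rw [Finset.mem_union, Finset.mem_filter, Finset.mem_Ioc, Finset.mem_Ioc]
          by_cases h : p ≤ m
          · exact Or.inl ⟨this, h⟩
          · exact Or.inr ⟨⟨by omega, by omega⟩, hp.2⟩
      _ ≤ _ := (Finset.card_union_le _ _).trans (by simp)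
  have : (N.primeCounting : ℝ) ≤ m + ((Finset.Ioc m N).filter Nat.Prime).card := by
    exact_mod_cast h
  linarith

theorem volume_exceptional_le_of_large {N : ℕ} {δ ε : ℝ} (hδ : δ ≤ ε) (hδ1 : δ ≤ 1) (hN : 4 ≤ N)
    (hL1 : 1 ≤ Real.log N) (hL8 : 8 * Real.log N ≤ N)
    (hpi : (N : ℝ) / 2 ≤ N * Real.log 2 - Real.log (N + 1))
    (hpow : Real.log N ^ (7 : ℕ) ≤ (N : ℝ) ^ δ) :
    volume {α : ℝ | α ∈ Set.Ico (0 : ℝ) 1 ∧ ¬ TwoRationalApprox 1 ε N α} ≤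
      ENNReal.ofReal (5 * 16 ^ 4 / Real.sqrt (Real.log N)) := by
  set T := Real.log N with hT
  have hN4 : (4 : ℝ) ≤ N := by exact_mod_cast hN
  have hN0 : (0 : ℝ) < N := by linarith
  have hT0 : 0 < T := by linarith
  -- Then `2Z ≤ N/(4T)`, half of the Chebyshev lower bound `N/(2T)` for the prime count, so at least
  -- `N/(4T)` primes remain above `2Z`.
  set Z := ⌊(N : ℝ) / (8 * T)⌋₊ with hZdef
  have hx1 : 1 ≤ (N : ℝ) / (8 * T) := by
    rw [le_div_iff₀ (by positivity)]
    linarith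
  have hZle : (Z : ℝ) ≤ N / (8 * T) := Nat.floor_le (by linarith)
  have hZ : 0 < Z := Nat.floor_pos.2 hx1
  have hZ1 : (1 : ℝ) ≤ Z := by exact_mod_cast hZ
  have hZge : (N : ℝ) / (16 * T) ≤ Z := by
    have h := Nat.lt_floor_add_one ((N : ℝ) / (8 * T))
    have e : (N : ℝ) / (16 * T) = N / (8 * T) / 2 := by
      field_simp
      norm_num
    rw [e]
    linarith
  have hZN : (2 * Z : ℝ) ≤ N := by
    have : (N : ℝ) / (8 * T) ≤ N / 8 := by
      gcongr
      linarith
    linarith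
  set Q := (Finset.Ioc (2 * Z) N).filter Nat.Prime with hQdef
  have hQcard : (N : ℝ) / (4 * T) ≤ Q.card := by
    have h1 := primeCounting_sub_le_card N (2 * Z)
    have h2 := Chebyshev.pi_ge N
    have h3 : (N : ℝ) / 2 / T ≤ (N * Real.log 2 - Real.log (N + 1)) / T := by gcongr
    have e1 : (N : ℝ) / 2 / T = 2 * (N / (4 * T)) := by
      field_simp
      norm_num
    have e2 : 2 * ((N : ℝ) / (8 * T)) = N / (4 * T) := by
      field_simp
      norm_num
    push_cast at h1
    linarith
  have hQpos : (0 : ℝ) < Q.card := lt_of_lt_of_le (by positivity) hQcard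
  have hQ0 : Q.Nonempty := Finset.card_pos.1 (by exact_mod_cast hQpos)
  have hη : 2 * (Z : ℝ) ^ 2 * (N : ℝ) ^ (δ - 4) ≤ 1 / 2 := by
    calc 2 * (Z : ℝ) ^ 2 * (N : ℝ) ^ (δ - 4)
        ≤ 2 * (N / 2) ^ 2 * (N : ℝ) ^ (-3 : ℝ) := by
          gcongr
          · linarith
          · linarith
          · linarith
      _ = (1 : ℝ) / (2 * N) := by
          rw [Real.rpow_neg hN0.le]
          norm_cast
          field_simp
          norm_num
          ring
      _ ≤ 1 / 2 := by
          gcongr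
          linarith
  refine (volume_exceptional_le hδ Q (fun p hp => ?_) hQ0 hZ hη).trans
    (ENNReal.ofReal_le_ofReal ?_)
  · rw [hQdef, Finset.mem_filter, Finset.mem_Ioc] at hp
    exact ⟨hp.2, hp.1.2, hp.1.1⟩
  have hratio : (N : ℝ) / Q.card ≤ 4 * T := by
    rw [div_le_iff₀ hQpos]
    rw [div_le_iff₀ (by positivity)] at hQcard
    linarith
  have hlog : Real.log (2 * Z) ≤ T := Real.log_le_log (by positivity) hZN
  have hlog0 : 0 ≤ Real.log (2 * Z) := Real.log_nonneg (by linarith)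
  have hden : (N : ℝ) ^ δ / (16 * T) ^ 4 ≤ Z ^ 2 * (N : ℝ) ^ (δ - 4) * Z ^ 2 := by
    have e : (N : ℝ) ^ (δ - 4) = (N : ℝ) ^ δ / N ^ 4 := by
      rw [Real.rpow_sub hN0]
      norm_cast
    calc (N : ℝ) ^ δ / (16 * T) ^ 4 = (N / (16 * T)) ^ 4 * (N : ℝ) ^ (δ - 4) := by
          rw [e, div_pow]
          field_simp
      _ ≤ Z ^ 4 * (N : ℝ) ^ (δ - 4) := by gcongr
      _ = _ := by ring
  have hNδ : 0 < (N : ℝ) ^ δ := by positivity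
  calc _ ≤ (5 * T) * (2 * T) / (2 * ((N : ℝ) ^ δ / (16 * T) ^ 4)) := by
        have h5 : 1 + (N : ℝ) / Q.card ≤ 5 * T := by linarith
        have h6 : 1 + Real.log (2 * Z) ≤ 2 * T := by linarith
        have h7 : 2 * ((N : ℝ) ^ δ / (16 * T) ^ 4) ≤
            2 * Z ^ 2 * (N : ℝ) ^ (δ - 4) * Z ^ 2 := by linarith
        gcongr
    _ = 5 * 16 ^ 4 * (T ^ 6 / (N : ℝ) ^ δ) := by
        field_simp
    _ ≤ 5 * 16 ^ 4 * (1 / T) := by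
        gcongr 5 * 16 ^ 4 * ?_
        rw [div_le_div_iff₀ hNδ hT0, one_mul, ← pow_succ]
        exact hpow
    _ ≤ 5 * 16 ^ 4 * (1 / Real.sqrt T) := by
        have : Real.sqrt T ≤ T := Real.sqrt_le_iff.2 ⟨hT0.le, by nlinarith⟩
        gcongr
    _ = _ := by ring

theorem eventually_large {δ : ℝ} (hδ : 0 < δ) :
    ∀ᶠ N : ℕ in Filter.atTop, 4 ≤ N ∧ 1 ≤ Real.log N ∧ 8 * Real.log N ≤ N ∧
      (N : ℝ) / 2 ≤ N * Real.log 2 - Real.log (N + 1) ∧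
      Real.log N ^ (7 : ℕ) ≤ (N : ℝ) ^ δ := by
  have hcast := tendsto_natCast_atTop_atTop (R := ℝ)
  have h2 := (Real.tendsto_log_atTop.comp hcast).eventually_ge_atTop 1
  -- With `1/20`, the loss `log (N + 1) ≤ 2 log N ≤ N/10` stays below `(log 2 - 1/2) N`.
  have h3 := hcast.eventually (Real.isLittleO_log_id_atTop.bound
    (show (0 : ℝ) < 1 / 20 by norm_num))
  have h5 := hcast.eventually ((isLittleO_log_rpow_rpow_atTop 7 hδ).bound one_pos)
  filter_upwards [Filter.eventually_ge_atTop 4, h2, h3, h5] with N hN h2 h3 h5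
  have hN4 : (4 : ℝ) ≤ N := by exact_mod_cast hN
  have hN0 : (0 : ℝ) < N := by linarith
  simp only [Function.comp_apply] at h2
  rw [Real.norm_of_nonneg (by linarith), id, Real.norm_of_nonneg hN0.le] at h3
  refine ⟨hN, h2, by linarith, ?_, ?_⟩
  · have hl : Real.log (N + 1) ≤ 2 * Real.log N := by
      have : Real.log ((N : ℝ) ^ 2) = 2 * Real.log N := by
        rw [Real.log_pow]
        norm_num
      rw [← this]
      exact Real.log_le_log (by positivity) (by nlinarith)
    have := Real.log_two_gt_d9
    nlinarith
  · have e : Real.log N ^ (7 : ℝ) = Real.log N ^ (7 : ℕ) := by norm_cast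
    rwa [e, one_mul, Real.norm_of_nonneg (by positivity),
      Real.norm_of_nonneg (by positivity)] at h5
theorem mainTheorem3 (ε : ℝ) (hε : 0 < ε) :
    ∃ C K : ℝ, 0 < C ∧ 0 < K ∧ ∀ N : ℕ, 1 ≤ N →
      MeasureTheory.volume {α : ℝ | α ∈ Set.Ico (0 : ℝ) 1 ∧ ¬ TwoRationalApprox C ε N α} ≤
        ENNReal.ofReal K / ENNReal.ofReal (Real.sqrt (Real.log (N : ℝ))) := by
  -- Here `δ = min ε 1`; the cap at `1` keeps `η ≤ 1/2`.
  obtain ⟨N₀, hN₀⟩ := Filter.eventually_atTop.1 (eventually_large (lt_min hε one_pos))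
  have hs : 0 ≤ Real.sqrt (Real.log N₀) := Real.sqrt_nonneg _
  -- The second summand of `K` makes the bound at least `1`, hence trivial, for `N ≤ N₀`; at `N = 1`
  -- the quotient by zero is `⊤`.
  refine ⟨1, 5 * 16 ^ 4 + Real.sqrt (Real.log N₀), one_pos, by positivity, fun N hN => ?_⟩
  have hN' : (1 : ℝ) ≤ N := by exact_mod_cast hN
  rcases le_total N₀ N with h | h
  · obtain ⟨h4, hL1, hL8, hpi, hpow⟩ := hN₀ N h
    have hpos : 0 < Real.sqrt (Real.log N) := Real.sqrt_pos.2 (by linarith)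
    refine (volume_exceptional_le_of_large (min_le_left ε 1) (min_le_right ε 1) h4 hL1 hL8 hpi
      hpow).trans ?_
    rw [ENNReal.ofReal_div_of_pos hpos]
    gcongr
    linarith
  · calc _ ≤ MeasureTheory.volume (Set.Ico (0 : ℝ) 1) :=
          MeasureTheory.measure_mono fun α hα => hα.1
      _ = 1 := by simp
      _ ≤ _ := by
        rw [ENNReal.le_div_iff_mul_le (Or.inr (ENNReal.ofReal_pos.2 (by positivity)).ne')
          (Or.inl ENNReal.ofReal_ne_top), one_mul]
        refine ENNReal.ofReal_le_ofReal ?_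
        have : Real.sqrt (Real.log N) ≤ Real.sqrt (Real.log N₀) :=
          Real.sqrt_le_sqrt (Real.log_le_log (by linarith) (by exact_mod_cast h))
        linarith
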